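/- Let $\mathbb X$ be a separable real Banach space, $(\Omega,\mathcal F,\mathbf P)$ a complete probability space and $\mathcal H\subseteq\mathcal F$ a sub-$\sigma$-algebra. For a sub-$\sigma$-algebra $\mathcal G\subseteq\mathcal F$, a $\mathcal G$-measurable random set in a separable Banach space $\mathbb E$ is a map $Z$ from $\Omega$ to the subsets of $\mathbb E$ (empty values are allowed) whose graph $\{(\omega,x): x\in Z(\omega)\}$ belongs to $\mathcal G\otimes\mathcal B(\mathbb E)$; it is called closed (convex) if $Z(\omega)$ is closed (convex) for almost all $\omega$. For a set-valued map $X$, the conditional core $\mathbf m(X|\mathcal H)$ is the largest $\mathcal H$-measurable random set $X'$ with $X'\subseteq X$ a.s. For a random set $X$, the conditional convex hull $\mathbf M(X|\mathcal H)$ is the smallest $\mathcal H$-measurable random convex closed set $X'$ with $X\subseteq X'$ a.s. Both are unique up to a.s. equality whenever they exist. For $A\subseteq\mathbb X$ let $$\operatorname{cone}(A)=\{(t,tx):\ t\ge 0,\ x\in A\}\subseteq\mathbb R\times\mathbb X \quad (A\neq\emptyset),\qquad \operatorname{cone}(\emptyset)=\{(0,0)\}.$$ Let $X$ be an $\mathcal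 F$-measurable random convex closed set in $\mathbb X$, and let $Y=\operatorname{cone}(X)$, that is, $Y(\omega)=\operatorname{cone}(X(\omega))$, considered in $\mathbb R\times\mathbb X$. Then $\mathbf m(X|\mathcal H)$, $\mathbf m(Y|\mathcal H)$ and $\mathbf M(X|\mathcal H)$ exist, and $$\mathbf m(Y|\mathcal H)=\operatorname{cone}(\mathbf m(X|\mathcal H))\quad\text{a.s.}$$ If $\mathbf M(X|\mathcal H)$ is a.s. bounded, then $\mathbf M(Y|\mathcal H)$ exists as well, and $$\mathbf M(Y|\mathcal H)=\operatorname{cone}(\mathbf M(X|\mathcal H))\quad\text{a.s.}$$ -/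

import Mathlib

open MeasureTheory Set

/-- `X` is a `G`-measurable random set: its graph `{(ω, x) : x ∈ X ω}` belongs to the product
of `G` and the Borel σ-algebra of `E`. -/
def IsRandomSet {Ω E : Type*} [mE : MeasurableSpace E] (G : MeasurableSpace Ω)
    (X : Ω → Set E) : Prop :=
  MeasurableSet[G.prod mE] {p : Ω × E | p.2 ∈ X p.1}

/-- `X` is a `G`-measurable random convex closed set; closedness and convexity hold for
almost all `ω`. Empty values are allowed. -/
structure IsRandomConvexClosed {Ω E : Type*} [NormedAddCommGroup E] [NormedSpace ℝ E]
    [MeasurableSpace E] {mΩ : MeasurableSpace Ω} (P : Measure Ω) (G : MeasurableSpace Ω)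
    (X : Ω → Set E) : Prop where
  measurable_graph : IsRandomSet G X
  closed : ∀ᵐ ω ∂P, IsClosed (X ω)
  convex : ∀ᵐ ω ∂P, Convex ℝ (X ω)

/-- `C` is (a version of) the conditional core of `X` given `H`: the largest `H`-measurable
random set that is almost surely contained in `X`. -/
structure IsCondCore {Ω E : Type*} [MeasurableSpace E] {mΩ : MeasurableSpace Ω}
    (P : Measure Ω) (H : MeasurableSpace Ω) (X C : Ω → Set E) : Prop where
  measurable_graph : IsRandomSet H C
  subset : ∀ᵐ ω ∂P, C ω ⊆ X ω
  largest : ∀ Z : Ω → Set E, IsRandomSet H Z → (∀ᵐ ω ∂P, Z ω ⊆ X ω) → ∀ᵐ ω ∂P, Z ω ⊆ C ω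

/-- `D` is (a version of) the conditional convex hull of `X` given `H`: the smallest
`H`-measurable random convex closed set that almost surely contains `X`. -/
structure IsCondConvexHull {Ω E : Type*} [NormedAddCommGroup E] [NormedSpace ℝ E]
    [MeasurableSpace E] {mΩ : MeasurableSpace Ω} (P : Measure Ω) (H : MeasurableSpace Ω)
    (X D : Ω → Set E) : Prop where
  convexClosed : IsRandomConvexClosed P H D
  superset : ∀ᵐ ω ∂P, X ω ⊆ D ω
  smallest : ∀ Z : Ω → Set E, IsRandomConvexClosed P H Z → (∀ᵐ ω ∂P, X ω ⊆ Z ω) →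
    ∀ᵐ ω ∂P, D ω ⊆ Z ω

/-- The cone `{(t, t x) : t ≥ 0, x ∈ A}` in `ℝ × E` generated by `A`. The origin belongs to the
cone; adding it explicitly matters only for `A = ∅`, whose cone is `{(0, 0)}`. -/
def perspectiveCone {E : Type*} [NormedAddCommGroup E] [NormedSpace ℝ E] (A : Set E) :
    Set (ℝ × E) :=
  insert 0 {p | ∃ t : ℝ, 0 ≤ t ∧ ∃ x ∈ A, p = (t, t • x)}

theorem perspectiveCone_of_nonempty {E : Type*} [NormedAddCommGroup E] [NormedSpace ℝ E]
    {A : Set E} (hA : A.Nonempty) :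
    perspectiveCone A = {p | ∃ t : ℝ, 0 ≤ t ∧ ∃ x ∈ A, p = (t, t • x)} := by
  obtain ⟨a, ha⟩ := hA
  exact insert_eq_of_mem ⟨0, le_rfl, a, ha, Prod.ext rfl (zero_smul ℝ a).symm⟩

/-- The conditional core is unique up to almost sure equality. -/
theorem IsCondCore.ae_eq {Ω E : Type*} [MeasurableSpace E] {mΩ : MeasurableSpace Ω}
    {P : Measure Ω} {H : MeasurableSpace Ω} {X C C' : Ω → Set E}
    (h : IsCondCore P H X C) (h' : IsCondCore P H X C') : ∀ᵐ ω ∂P, C ω = C' ω := by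
  filter_upwards [h.largest C' h'.measurable_graph h'.subset,
    h'.largest C h.measurable_graph h.subset] with ω h1 h2
  exact Subset.antisymm h2 h1

/-- The conditional convex hull is unique up to almost sure equality. -/
theorem IsCondConvexHull.ae_eq {Ω E : Type*} [NormedAddCommGroup E] [NormedSpace ℝ E]
    [MeasurableSpace E] {mΩ : MeasurableSpace Ω} {P : Measure Ω} {H : MeasurableSpace Ω}
    {X D D' : Ω → Set E} (h : IsCondConvexHull P H X D) (h' : IsCondConvexHull P H X D') :
    ∀ᵐ ω ∂P, D ω = D' ω := by
  filter_upwards [h.smallest D' h'.convexClosed h'.superset,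
    h'.smallest D h.convexClosed h.superset] with ω h1 h2
  exact Subset.antisymm h1 h2

/-! A closed set is determined by the members of a countable basis that it hits, so both existence
claims reduce to events "the set hits `U`". Such events are projections of measurable graphs; by the
measurable projection theorem they agree a.s. with events of `H`. For the core, choose for each `U`
an admissible set maximizing the probability of hitting `U`; the closure of the union over `U` is
the core. For the hull, take for each `U` the smallest `H`-event on which `X` may hit `U`; these
events define a smallest closed random superset, whose closed convex hull is the answer.

Away from the origin, the cone is the preimage of the set under `(t, y) ↦ t⁻¹ y`. Pushing an
`H`-measurable subset of `cone X` through this map gives the core identity; slicing an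
`H`-measurable convex closed superset at rational heights gives the hull identity. Boundedness only
serves to make the cone over the hull closed. -/

/-! ### Analytic sets and measurable projection -/

open Filter Topology in
/-- A continuous image of Baire space is approximated from inside, in outer measure, by
compact sets. -/
theorem exists_isCompact_lt_measure_range {T : Type*} [TopologicalSpace T] [MeasurableSpace T]
    (μ : Measure T) [μ.OuterRegular] {f : (ℕ → ℕ) → T} (hf : Continuous f) {c : ENNReal}
    (hc : c < μ (range f)) : ∃ K ⊆ range f, IsCompact K ∧ c ≤ μ K := by
  have step : ∀ (n : ℕ) (S : {S : Set (ℕ → ℕ) // c < μ (f '' S)}),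
      ∃ m : ℕ, c < μ (f '' (S.1 ∩ {x | x n ≤ m})) := by
    rintro n ⟨S, hS⟩
    have h1 : f '' S = ⋃ m : ℕ, f '' (S ∩ {x | x n ≤ m}) := by
      rw [← image_iUnion, ← inter_iUnion]
      congr 1
      refine (inter_eq_left.2 fun x _ => mem_iUnion.2 ⟨x n, ?_⟩).symm
      exact le_refl (x n)
    have h2 : Monotone fun m : ℕ => f '' (S ∩ {x | x n ≤ m}) := fun a b hab =>
      image_mono (inter_subset_inter_right _ fun x (hx : x n ≤ a) => hx.trans hab)
    -- Continuity from below along increasing unions holds for outer measure, so the images need not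
    -- be measurable.
    rw [h1, h2.measure_iUnion, lt_iSup_iff] at hS
    exact hS
  choose m hm using step
  let S : ℕ → {S : Set (ℕ → ℕ) // c < μ (f '' S)} := fun n =>
    Nat.rec ⟨univ, by simpa using hc⟩ (fun n S => ⟨S.1 ∩ {x | x n ≤ m n S}, hm n S⟩) n
  let k : ℕ → ℕ := fun n => m n (S n)
  have hS : ∀ n x, x ∈ (S n).1 ↔ ∀ i < n, x i ≤ k i := by
    intro n
    induction n with
    | zero => intro x; simp [S]
    | succ n ih =>
      intro x
      have : x ∈ (S (n + 1)).1 ↔ x ∈ (S n).1 ∧ x n ≤ k n := Iff.rfl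
      rw [this, ih, Nat.forall_lt_succ_right]
  let K : Set (ℕ → ℕ) := univ.pi fun i => Iic (k i)
  have hK : IsCompact K := isCompact_univ_pi fun i => (finite_Iic (k i)).isCompact
  refine ⟨f '' K, image_subset_range _ _, hK.image hf, ?_⟩
  rw [Set.measure_eq_iInf_isOpen]
  refine le_iInf₂ fun U hKU => le_iInf fun hU => ?_
  obtain ⟨n, hn⟩ : ∃ n, f '' (S n).1 ⊆ U := by
    by_contra! hcon
    have hx : ∀ n, ∃ x ∈ (S n).1, f x ∉ U := fun n => by
      obtain ⟨y, ⟨x, hx, rfl⟩, hy⟩ := not_subset.1 (hcon n)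
      exact ⟨x, hx, hy⟩
    choose x hx hxU using hx
    -- Truncation by `k` moves `x n` into `K` without changing its coordinates below `n`, so limits
    -- are unaffected.
    obtain ⟨y, hy, φ, hφ, hlim⟩ := hK.tendsto_subseq (x := fun n i => min (x n i) (k i))
      fun n i _ => mem_Iic.2 (min_le_right _ _)
    have hlim' : Tendsto (x ∘ φ) atTop (𝓝 y) := by
      rw [tendsto_pi_nhds] at hlim ⊢
      intro i
      refine (hlim i).congr' ?_
      filter_upwards [eventually_gt_atTop i] with n hn
      exact min_eq_left ((hS _ _).1 (hx (φ n)) i (hn.trans_le (hφ.id_le n)))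
    exact (hU.isClosed_compl.preimage hf).mem_of_tendsto hlim'
      (Eventually.of_forall fun n => hxU (φ n)) (hKU (mem_image_of_mem f hy))
  exact (S n).2.le.trans (measure_mono hn)

/-- Analytic sets are universally measurable. -/
theorem MeasureTheory.AnalyticSet.nullMeasurableSet {T : Type*} [TopologicalSpace T] [T2Space T]
    [MeasurableSpace T] [OpensMeasurableSpace T] (μ : Measure T) [IsFiniteMeasure μ]
    [μ.OuterRegular] {A : Set T} (hA : AnalyticSet A) : NullMeasurableSet A μ := by
  rw [AnalyticSet] at hA
  rcases hA with rfl | ⟨f, hf, rfl⟩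
  · exact nullMeasurableSet_empty
  rcases eq_or_ne (μ (range f)) 0 with h0 | h0
  · exact NullMeasurableSet.of_null h0
  obtain ⟨u, -, hu, hlim⟩ := exists_seq_strictMono_tendsto' (bot_lt_iff_ne_bot.2 h0)
  choose K hKs hK hKu using fun n =>
    exists_isCompact_lt_measure_range μ hf (hu n).2
  have hsub : (⋃ n, K n) ⊆ range f := iUnion_subset hKs
  have hle : μ (range f) ≤ μ (⋃ n, K n) :=
    le_of_tendsto' hlim fun n => (hKu n).trans (measure_mono (subset_iUnion K n))
  have hmeas : NullMeasurableSet (⋃ n, K n) μ :=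
    (MeasurableSet.iUnion fun n => (hK n).measurableSet).nullMeasurableSet
  exact hmeas.congr (ae_eq_of_ae_subset_of_measure_ge hsub.eventuallyLE hle hmeas
    (measure_ne_top μ _))

/-- Every measurable subset of a product is the pullback of a measurable set along a map of the
first factor into Baire space. -/
theorem exists_measurable_baire_preimage_prod {Ω F : Type*} [MeasurableSpace Ω]
    [MeasurableSpace F] {G : Set (Ω × F)} (hG : MeasurableSet G) :
    ∃ (φ : Ω → ℕ → ℕ) (G' : Set ((ℕ → ℕ) × F)), Measurable φ ∧ MeasurableSet G' ∧
      G = Prod.map φ id ⁻¹' G' := by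
  classical
  have hG' : MeasurableSet[MeasurableSpace.generateFrom
      (image2 (· ×ˢ ·) {s : Set Ω | MeasurableSet s} {t : Set F | MeasurableSet t})] G := by
    rwa [generateFrom_prod]
  induction G, hG' using MeasurableSpace.generateFrom_induction with
  | hC t ht _ =>
    obtain ⟨a, ha, b, hb, rfl⟩ := ht
    refine ⟨fun ω _ => if ω ∈ a then 1 else 0, {x | x 0 = 1} ×ˢ b, ?_, ?_, ?_⟩
    · exact measurable_pi_lambda _ fun _ => Measurable.ite ha measurable_const measurable_const
    · exact (measurableSet_eq_fun (measurable_pi_apply 0) measurable_const).prod hb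
    · ext ⟨ω, y⟩
      simp
  | empty => exact ⟨fun _ _ => 0, ∅, measurable_const, MeasurableSet.empty, rfl⟩
  | compl t ht ih =>
    obtain ⟨φ, G', hφ, hG', rfl⟩ := ih (by rwa [generateFrom_prod] at ht)
    exact ⟨φ, G'ᶜ, hφ, hG'.compl, rfl⟩
  | iUnion s hs ih =>
    choose φ G' hφ hG' hs' using fun n => ih n (by have := hs n; rwa [generateFrom_prod] at this)
    -- Countably many codings are interleaved into one by the pairing function.
    refine ⟨fun ω k => φ k.unpair.1 ω k.unpair.2,
      ⋃ n, Prod.map (fun x i => x (Nat.pair n i)) id ⁻¹' G' n, ?_, ?_, ?_⟩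
    · exact measurable_pi_lambda _ fun k => (measurable_pi_apply _).comp (hφ _)
    · refine MeasurableSet.iUnion fun n => Measurable.prodMap ?_ measurable_id (hG' n)
      exact measurable_pi_lambda _ fun i => measurable_pi_apply _
    · rw [preimage_iUnion]
      refine iUnion_congr fun n => ?_
      rw [hs' n, ← preimage_comp]
      congr 1
      ext ⟨ω, y⟩ <;> simp

/-- The measurable projection theorem: the projection along a Polish space of a measurable set
is null measurable. -/
theorem nullMeasurableSet_image_fst {Ω F : Type*} [MeasurableSpace Ω] [TopologicalSpace F]
    [PolishSpace F] [MeasurableSpace F] [BorelSpace F] (μ : Measure Ω) [IsFiniteMeasure μ]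
    {G : Set (Ω × F)} (hG : MeasurableSet G) : NullMeasurableSet (Prod.fst '' G) μ := by
  obtain ⟨φ, G', hφ, hG', rfl⟩ := exists_measurable_baire_preimage_prod hG
  have h1 : AnalyticSet (Prod.fst '' G') := hG'.analyticSet.image_of_continuous continuous_fst
  have h2 := (h1.nullMeasurableSet (μ.map φ)).preimage (f := φ)
    ⟨hφ, Measure.AbsolutelyContinuous.rfl⟩
  convert h2 using 1
  ext ω
  simp

/-- The set where a random set in a Polish space is nonempty is almost surely equal to an event
of the σ-algebra with respect to which the random set is measurable. -/
theorem IsRandomSet.exists_ae_iff_nonempty {Ω F : Type*} [TopologicalSpace F] [PolishSpace F]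
    [MeasurableSpace F] [BorelSpace F] {H mΩ : MeasurableSpace Ω} (hH : H ≤ mΩ) (P : Measure Ω)
    [IsFiniteMeasure P] {Z : Ω → Set F} (hZ : IsRandomSet H Z) :
    ∃ A, MeasurableSet[H] A ∧ ∀ᵐ ω ∂P, ω ∈ A ↔ (Z ω).Nonempty := by
  -- Projecting under the trimmed measure keeps the approximating event in `H`.
  have h := @nullMeasurableSet_image_fst Ω F H _ _ _ _ (P.trim hH) _ _ hZ
  obtain ⟨A, -, hA, hAe⟩ := h.exists_measurable_superset_ae_eq
  refine ⟨A, hA, ?_⟩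
  filter_upwards [ae_of_ae_trim hH hAe.mem_iff] with ω hω
  rw [hω]
  simp [Set.Nonempty]

/-! ### Operations on random sets -/

theorem IsRandomSet.union {Ω E : Type*} [MeasurableSpace E] {G : MeasurableSpace Ω}
    {X Y : Ω → Set E} (hX : IsRandomSet G X) (hY : IsRandomSet G Y) :
    IsRandomSet G fun ω => X ω ∪ Y ω :=
  MeasurableSet.union hX hY

theorem IsRandomSet.iUnion {Ω E ι : Type*} [Countable ι] [MeasurableSpace E]
    {G : MeasurableSpace Ω} {X : ι → Ω → Set E} (hX : ∀ i, IsRandomSet G (X i)) :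
    IsRandomSet G fun ω => ⋃ i, X i ω := by
  have : MeasurableSet[G.prod _] (⋃ i, {p : Ω × E | p.2 ∈ X i p.1}) := MeasurableSet.iUnion hX
  unfold IsRandomSet
  convert this using 1
  ext p
  simp

theorem IsRandomSet.inter {Ω E : Type*} [MeasurableSpace E] {G : MeasurableSpace Ω}
    {X Y : Ω → Set E} (hX : IsRandomSet G X) (hY : IsRandomSet G Y) :
    IsRandomSet G fun ω => X ω ∩ Y ω :=
  MeasurableSet.inter hX hY

theorem IsRandomSet.const {Ω E : Type*} [MeasurableSpace E] (G : MeasurableSpace Ω)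
    {B : Set E} (hB : MeasurableSet B) : IsRandomSet G fun _ : Ω => B :=
  @measurable_snd Ω E G _ _ hB

theorem IsRandomSet.preimage {Ω E F : Type*} [MeasurableSpace E] [MeasurableSpace F]
    {G : MeasurableSpace Ω} {X : Ω → Set E} (hX : IsRandomSet G X) {g : F → E}
    (hg : Measurable g) : IsRandomSet G fun ω => g ⁻¹' X ω :=
  (measurable_fst.prodMk (hg.comp measurable_snd) :
    Measurable[G.prod _, G.prod _] fun p : Ω × F => (p.1, g p.2)) hX

/-- A set-valued map given by events indexed by a countable topological basis. -/
theorem isRandomSet_of_countableBasis {Ω E : Type*} [TopologicalSpace E]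
    [SecondCountableTopology E] [MeasurableSpace E] [OpensMeasurableSpace E]
    {H : MeasurableSpace Ω} {A : TopologicalSpace.countableBasis E → Set Ω}
    (hA : ∀ U, MeasurableSet[H] (A U)) :
    IsRandomSet H fun ω => {x | ∀ U : TopologicalSpace.countableBasis E, x ∈ U.1 → ω ∈ A U} := by
  have : MeasurableSet[H.prod _] (⋂ U : TopologicalSpace.countableBasis E,
      ((Prod.snd ⁻¹' U.1 : Set (Ω × E))ᶜ ∪ Prod.fst ⁻¹' A U)) :=
    MeasurableSet.iInter fun U => MeasurableSet.union
      (@measurable_snd Ω E H _ _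
        (TopologicalSpace.isOpen_of_mem_countableBasis U.2).measurableSet).compl
      (@measurable_fst Ω E H _ _ (hA U))
  unfold IsRandomSet
  convert this using 1
  ext p
  simp [imp_iff_not_or]

theorem isClosed_setOf_countableBasis {E : Type*} [TopologicalSpace E]
    [SecondCountableTopology E] (p : TopologicalSpace.countableBasis E → Prop) :
    IsClosed {x : E | ∀ U : TopologicalSpace.countableBasis E, x ∈ U.1 → p U} := by
  have : {x : E | ∀ U : TopologicalSpace.countableBasis E, x ∈ U.1 → p U} =
      ⋂ (U : TopologicalSpace.countableBasis E) (_ : ¬ p U), (U.1)ᶜ := by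
    ext x
    simp only [mem_ofPred_eq, mem_iInter, mem_compl_iff]
    exact forall_congr' fun U => not_imp_not.symm
  rw [this]
  exact isClosed_biInter fun U _ =>
    (TopologicalSpace.isOpen_of_mem_countableBasis U.2).isClosed_compl

theorem mem_closure_iff_countableBasis {E : Type*} [TopologicalSpace E]
    [SecondCountableTopology E] {s : Set E} {x : E} :
    x ∈ closure s ↔ ∀ U : TopologicalSpace.countableBasis E, x ∈ U.1 → (s ∩ U.1).Nonempty := by
  rw [(TopologicalSpace.isBasis_countableBasis E).mem_closure_iff]
  simp [inter_comm]

/-- If a set-valued map hits basic open sets on measurable events, up to null sets, then its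
closure is almost surely equal to a random set. -/
theorem exists_isRandomSet_ae_eq_closure {Ω E : Type*} [TopologicalSpace E]
    [SecondCountableTopology E] [MeasurableSpace E] [OpensMeasurableSpace E]
    {H mΩ : MeasurableSpace Ω} {P : Measure Ω} {W : Ω → Set E}
    (hW : ∀ U : TopologicalSpace.countableBasis E,
      ∃ A, MeasurableSet[H] A ∧ ∀ᵐ ω ∂P, ω ∈ A ↔ (W ω ∩ U.1).Nonempty) :
    ∃ V : Ω → Set E, IsRandomSet H V ∧ ∀ᵐ ω ∂P, V ω = closure (W ω) := by
  choose A hA hAW using hW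
  refine ⟨_, isRandomSet_of_countableBasis hA, ?_⟩
  filter_upwards [ae_all_iff.2 hAW] with ω hω
  ext x
  simp only [mem_closure_iff_countableBasis, mem_ofPred_eq, hω]

/-- The closure of a countable union of measurable images of random sets is almost surely equal to
a random set. -/
theorem IsRandomSet.exists_ae_eq_closure_iUnion_image {Ω E ι : Type*} {F : ι → Type*}
    [Countable ι] [TopologicalSpace E] [SecondCountableTopology E] [MeasurableSpace E]
    [OpensMeasurableSpace E] [∀ i, TopologicalSpace (F i)] [∀ i, PolishSpace (F i)]
    [∀ i, MeasurableSpace (F i)] [∀ i, BorelSpace (F i)]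
    {H mΩ : MeasurableSpace Ω} (hH : H ≤ mΩ) (P : Measure Ω) [IsFiniteMeasure P]
    {Z : ∀ i, Ω → Set (F i)} (hZ : ∀ i, IsRandomSet H (Z i)) {g : ∀ i, F i → E}
    (hg : ∀ i, Measurable (g i)) :
    ∃ V : Ω → Set E, IsRandomSet H V ∧ ∀ᵐ ω ∂P, V ω = closure (⋃ i, g i '' Z i ω) := by
  refine exists_isRandomSet_ae_eq_closure fun U => ?_
  have hU : MeasurableSet U.1 :=
    (TopologicalSpace.isOpen_of_mem_countableBasis U.2).measurableSet
  choose A hA hAZ using fun i =>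
    ((hZ i).inter (.const H (hg i hU))).exists_ae_iff_nonempty hH P
  refine ⟨⋃ i, A i, MeasurableSet.iUnion hA, ?_⟩
  filter_upwards [ae_all_iff.2 hAZ] with ω hω
  simp only [mem_iUnion, hω, iUnion_inter, nonempty_iUnion, image_inter_nonempty_iff]

theorem IsRandomSet.exists_ae_eq_closure_image {Ω E F : Type*}
    [TopologicalSpace E] [SecondCountableTopology E] [MeasurableSpace E]
    [OpensMeasurableSpace E] [TopologicalSpace F] [PolishSpace F]
    [MeasurableSpace F] [BorelSpace F]
    {H mΩ : MeasurableSpace Ω} (hH : H ≤ mΩ) (P : Measure Ω) [IsFiniteMeasure P]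
    {Z : Ω → Set F} (hZ : IsRandomSet H Z) {g : F → E} (hg : Measurable g) :
    ∃ V : Ω → Set E, IsRandomSet H V ∧ ∀ᵐ ω ∂P, V ω = closure (g '' Z ω) := by
  simpa only [iUnion_const] using IsRandomSet.exists_ae_eq_closure_iUnion_image
    (ι := Unit) (F := fun _ => F) hH P (fun _ => hZ) (fun _ => hg)

/-! ### Existence of the core and of the smallest closed superset -/

/-- A monotone functional attains its maximum on a family closed under countable suprema. -/
theorem exists_forall_le_of_iSup_mem {α : Type*} [CompleteLattice α] {S : Set α}
    (hne : S.Nonempty) (hS : ∀ f : ℕ → α, (∀ n, f n ∈ S) → ⨆ n, f n ∈ S) {φ : α → ENNReal}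
    (hφ : Monotone φ) : ∃ a ∈ S, ∀ b ∈ S, φ b ≤ φ a := by
  obtain ⟨u, -, hu, huS⟩ := exists_seq_tendsto_sSup (hne.image φ) (OrderTop.bddAbove _)
  choose f hf hfu using huS
  refine ⟨_, hS f hf, fun b hb => (le_sSup (mem_image_of_mem φ hb)).trans ?_⟩
  exact le_of_tendsto' hu fun n => hfu n ▸ hφ (le_iSup f n)

theorem ae_iUnion_subset {Ω E ι : Type*} [Countable ι] [MeasurableSpace Ω] {P : Measure Ω}
    {Z : ι → Ω → Set E} {X : Ω → Set E} (h : ∀ i, ∀ᵐ ω ∂P, Z i ω ⊆ X ω) :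
    ∀ᵐ ω ∂P, ⋃ i, Z i ω ⊆ X ω :=
  (ae_all_iff.2 h).mono fun _ => iUnion_subset

/-- The conditional core of a random set with almost surely closed values exists. -/
theorem exists_isCondCore {Ω E : Type*} [TopologicalSpace E] [PolishSpace E] [MeasurableSpace E]
    [BorelSpace E] {H mΩ : MeasurableSpace Ω} (hH : H ≤ mΩ) (P : Measure Ω) [IsFiniteMeasure P]
    {X : Ω → Set E} (hX : ∀ᵐ ω ∂P, IsClosed (X ω)) : ∃ C : Ω → Set E, IsCondCore P H X C := by
  let S : Set (Ω → Set E) := {Z | IsRandomSet H Z ∧ ∀ᵐ ω ∂P, Z ω ⊆ X ω}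
  have hmax : ∀ U : TopologicalSpace.countableBasis E, ∃ M ∈ S, ∀ Z ∈ S,
      P {ω | (Z ω ∩ U.1).Nonempty} ≤ P {ω | (M ω ∩ U.1).Nonempty} := by
    intro U
    refine exists_forall_le_of_iSup_mem (S := S)
      (φ := fun Z : Ω → Set E => P {ω | (Z ω ∩ U.1).Nonempty})
      ⟨fun _ => ∅, .const H .empty, by simp⟩ (fun f hf => ?_) ?_
    · have : (⨆ n, f n) = fun ω => ⋃ n, f n ω := by
        ext ω
        simp
      rw [this]
      exact ⟨.iUnion fun n => (hf n).1, ae_iUnion_subset fun n => (hf n).2⟩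
    · exact fun Z Z' hZ => measure_mono fun ω h => h.mono (inter_subset_inter_left _ (hZ ω))
  choose M hM hMmax using hmax
  obtain ⟨V, hV, hVM⟩ := (IsRandomSet.iUnion fun U => (hM U).1).exists_ae_eq_closure_image
    hH P measurable_id
  refine ⟨V, hV, ?_, fun Z hZ hZX => ?_⟩
  · filter_upwards [hVM, ae_iUnion_subset fun U => (hM U).2, hX] with ω h1 h2 h3
    rw [h1, image_id]
    exact closure_minimal h2 h3
  have hit : ∀ U : TopologicalSpace.countableBasis E, ∀ᵐ ω ∂P,
      (Z ω ∩ U.1).Nonempty → (M U ω ∩ U.1).Nonempty := by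
    intro U
    have hU : MeasurableSet U.1 :=
      (TopologicalSpace.isOpen_of_mem_countableBasis U.2).measurableSet
    -- Adjoining `Z` keeps `M U` admissible, so by maximality it cannot hit `U` on a larger event.
    have hZM : (fun ω => Z ω ∪ M U ω) ∈ S := by
      refine ⟨hZ.union (hM U).1, ?_⟩
      filter_upwards [hZX, (hM U).2] with ω h1 h2 using union_subset h1 h2
    obtain ⟨A, hA, hAM⟩ := ((hM U).1.inter (.const H hU)).exists_ae_iff_nonempty hH P
    have hnull : NullMeasurableSet {ω | (M U ω ∩ U.1).Nonempty} P :=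
      (hH _ hA).nullMeasurableSet.congr (Filter.eventuallyEq_set.2 hAM)
    have hsub : {ω | (M U ω ∩ U.1).Nonempty} ⊆ {ω | ((Z ω ∪ M U ω) ∩ U.1).Nonempty} :=
      fun ω h => h.mono (inter_subset_inter_left _ subset_union_right)
    have := ae_eq_of_ae_subset_of_measure_ge hsub.eventuallyLE (hMmax U _ hZM) hnull
      (measure_ne_top P _)
    filter_upwards [this.mem_iff] with ω hω h
    exact hω.2 (h.mono (inter_subset_inter_left _ subset_union_left))
  filter_upwards [hVM, ae_all_iff.2 hit] with ω h1 h2 x hx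
  rw [h1, image_id, mem_closure_iff_countableBasis]
  exact fun U hxU => (h2 U ⟨x, hx, hxU⟩).mono
    (inter_subset_inter_left _ (subset_iUnion (fun U => M U ω) U))

/-- Every set is almost surely contained in a smallest event of a sub-σ-algebra. -/
theorem exists_minimal_measurable_ae_superset {Ω : Type*} {H mΩ : MeasurableSpace Ω}
    (hH : H ≤ mΩ) (P : Measure Ω) [IsFiniteMeasure P] (s : Set Ω) :
    ∃ A, MeasurableSet[H] A ∧ (∀ᵐ ω ∂P, ω ∈ s → ω ∈ A) ∧
      ∀ B, MeasurableSet[H] B → (∀ᵐ ω ∂P, ω ∈ s → ω ∈ B) → ∀ᵐ ω ∂P, ω ∈ A → ω ∈ B := by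
  -- The smallest event is the complement of the largest event of `H` a.s. disjoint from `s`.
  obtain ⟨A, ⟨hA, hAs⟩, hmax⟩ := exists_forall_le_of_iSup_mem (φ := P)
    (S := {A : Set Ω | MeasurableSet[H] A ∧ ∀ᵐ ω ∂P, ω ∈ A → ω ∉ s})
    ⟨∅, @MeasurableSet.empty Ω H, by simp⟩
    (fun f hf => ⟨@MeasurableSet.iUnion Ω ℕ H _ f fun n => (hf n).1, by
      filter_upwards [ae_all_iff.2 fun n => (hf n).2] with ω hω h
      obtain ⟨n, hn⟩ := mem_iUnion.1 h
      exact hω n hn⟩)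
    (fun _ _ => measure_mono)
  refine ⟨Aᶜ, hA.compl, ?_, fun B hB hBs => ?_⟩
  · filter_upwards [hAs] with ω h1 h2 h3 using h1 h3 h2
  have hle := hmax (A ∪ Bᶜ) ⟨hA.union hB.compl, by
    filter_upwards [hAs, hBs] with ω h1 h2 h3 h4
    exact h3.elim (fun h => h1 h h4) fun h => h (h2 h4)⟩
  have := ae_eq_of_ae_subset_of_measure_ge subset_union_left.eventuallyLE hle
    (hH _ hA).nullMeasurableSet (measure_ne_top P _)
  filter_upwards [this.mem_iff] with ω hω h
  by_contra hB
  exact h (hω.2 (Or.inr hB))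

/-- Every set-valued map is almost surely contained in a smallest random set with closed values. -/
theorem exists_minimal_isRandomSet_isClosed {Ω E : Type*} [TopologicalSpace E] [PolishSpace E]
    [MeasurableSpace E] [BorelSpace E] {H mΩ : MeasurableSpace Ω} (hH : H ≤ mΩ) (P : Measure Ω)
    [IsFiniteMeasure P] (X : Ω → Set E) :
    ∃ S : Ω → Set E, IsRandomSet H S ∧ (∀ ω, IsClosed (S ω)) ∧ (∀ᵐ ω ∂P, X ω ⊆ S ω) ∧
      ∀ Z : Ω → Set E, IsRandomSet H Z → (∀ᵐ ω ∂P, IsClosed (Z ω)) → (∀ᵐ ω ∂P, X ω ⊆ Z ω) →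
        ∀ᵐ ω ∂P, S ω ⊆ Z ω := by
  choose A hA hXA hmin using fun U : TopologicalSpace.countableBasis E =>
    exists_minimal_measurable_ae_superset hH P {ω | (X ω ∩ U.1).Nonempty}
  refine ⟨_, isRandomSet_of_countableBasis hA, fun ω => isClosed_setOf_countableBasis _, ?_,
    fun Z hZ hZc hXZ => ?_⟩
  · filter_upwards [ae_all_iff.2 hXA] with ω hω x hx U hxU
    exact hω U ⟨x, hx, hxU⟩
  have hit : ∀ U : TopologicalSpace.countableBasis E, ∀ᵐ ω ∂P,
      ω ∈ A U → (Z ω ∩ U.1).Nonempty := by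
    intro U
    have hU : MeasurableSet U.1 :=
      (TopologicalSpace.isOpen_of_mem_countableBasis U.2).measurableSet
    obtain ⟨B, hB, hBZ⟩ := (hZ.inter (.const H hU)).exists_ae_iff_nonempty hH P
    have := hmin U B hB (by
      filter_upwards [hBZ, hXZ] with ω h1 h2 h3
      exact h1.2 (h3.mono (inter_subset_inter_left _ h2)))
    filter_upwards [this, hBZ] with ω h1 h2 h3 using h2.1 (h1 h3)
  filter_upwards [ae_all_iff.2 hit, hZc] with ω h1 h2 x hx
  rw [← h2.closure_eq, mem_closure_iff_countableBasis]
  exact fun U hxU => h1 U (hx U hxU)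

/-! ### Closed convex hulls -/

/-- Indexing by `Fin n` presents the hull as a countable union of images of subsets of the spaces
`Fin n → ℝ × E`, which are Polish for separable Banach `E`. -/
theorem mem_convexHull_iff_exists_fin {E : Type*} [AddCommGroup E] [Module ℝ E] {s : Set E}
    {x : E} : x ∈ convexHull ℝ s ↔ ∃ (n : ℕ) (p : Fin n → ℝ × E),
      (∀ i, 0 ≤ (p i).1) ∧ ∑ i, (p i).1 = 1 ∧ (∀ i, (p i).2 ∈ s) ∧
        ∑ i, (p i).1 • (p i).2 = x := by
  rw [mem_convexHull_iff_exists_fintype]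
  constructor
  · rintro ⟨ι, _, w, z, hw, hw1, hz, rfl⟩
    let e := (Fintype.equivFin ι).symm
    exact ⟨Fintype.card ι, fun i => (w (e i), z (e i)), fun i => hw _,
      (e.sum_comp w).trans hw1, fun i => hz _, e.sum_comp fun i => w i • z i⟩
  · rintro ⟨n, p, hw, hw1, hz, rfl⟩
    exact ⟨Fin n, inferInstance, fun i => (p i).1, fun i => (p i).2, hw, hw1, hz, rfl⟩

section Banach

variable {Ω E : Type*} [NormedAddCommGroup E] [NormedSpace ℝ E]
  [SecondCountableTopology E] [MeasurableSpace E] [BorelSpace E]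
  {H mΩ : MeasurableSpace Ω}

/-- The closed convex hull of a random set is almost surely equal to a random set. -/
theorem IsRandomSet.exists_ae_eq_closure_convexHull [CompleteSpace E] (hH : H ≤ mΩ) (P : Measure Ω)
    [IsFiniteMeasure P] {S : Ω → Set E} (hS : IsRandomSet H S) :
    ∃ V : Ω → Set E, IsRandomSet H V ∧ ∀ᵐ ω ∂P, V ω = closure (convexHull ℝ (S ω)) := by
  let B : ∀ n, Set (Fin n → ℝ × E) := fun n => {p | (∀ i, 0 ≤ (p i).1) ∧ ∑ i, (p i).1 = 1}
  have hB : ∀ n, MeasurableSet (B n) := fun n => by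
    refine MeasurableSet.inter (s₁ := {p : Fin n → ℝ × E | ∀ i, 0 ≤ (p i).1}) ?_ ?_
    · rw [ofPred_forall]
      exact MeasurableSet.iInter fun i => measurableSet_le measurable_const (by fun_prop)
    · exact measurableSet_eq_fun (by fun_prop) measurable_const
  let Z : ∀ n, Ω → Set (Fin n → ℝ × E) := fun n ω =>
    B n ∩ {p | ∀ i, (p i).2 ∈ S ω}
  have hZ : ∀ n, IsRandomSet H (Z n) := fun n => by
    refine (IsRandomSet.const H (hB n)).inter ?_
    have : MeasurableSet[H.prod _] (⋂ i : Fin n, {q : Ω × (Fin n → ℝ × E) | (q.2 i).2 ∈ S q.1}) :=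
      MeasurableSet.iInter fun i => hS.preimage (g := fun p : Fin n → ℝ × E => (p i).2)
        (by fun_prop)
    unfold IsRandomSet
    convert this using 1
    ext q
    simp
  obtain ⟨V, hV, hVS⟩ := IsRandomSet.exists_ae_eq_closure_iUnion_image hH P hZ
    (g := fun n p => ∑ i, (p i).1 • (p i).2) (fun n => by fun_prop)
  refine ⟨V, hV, hVS.mono fun ω hω => ?_⟩
  rw [hω]
  congr 1
  ext x
  simp only [mem_iUnion, mem_convexHull_iff_exists_fin, Z, B, mem_image, mem_inter_iff,
    mem_ofPred_eq, and_assoc]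

/-- The conditional convex hull of an arbitrary set-valued map exists. -/
theorem exists_isCondConvexHull [CompleteSpace E] (hH : H ≤ mΩ) (P : Measure Ω)
    [IsFiniteMeasure P] (X : Ω → Set E) : ∃ D : Ω → Set E, IsCondConvexHull P H X D := by
  obtain ⟨S, hS, -, hXS, hmin⟩ := exists_minimal_isRandomSet_isClosed hH P X
  obtain ⟨D, hD, hDS⟩ := hS.exists_ae_eq_closure_convexHull hH P
  refine ⟨D, ⟨hD, ?_, ?_⟩, ?_, fun Z hZ hXZ => ?_⟩
  · filter_upwards [hDS] with ω h using h ▸ isClosed_closure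
  · filter_upwards [hDS] with ω h using h ▸ (convex_convexHull ℝ _).closure
  · filter_upwards [hDS, hXS] with ω h h'
    rw [h]
    exact h'.trans ((subset_convexHull ℝ _).trans subset_closure)
  · filter_upwards [hDS, hmin Z hZ.measurable_graph hZ.closed hXZ, hZ.closed, hZ.convex]
      with ω h1 h2 h3 h4
    rw [h1]
    exact closure_minimal (convexHull_min h2 h4) h3

end Banach

/-! ### Geometry and measurability of the cone -/

section PerspectiveCone

variable {E : Type*} [NormedAddCommGroup E] [NormedSpace ℝ E]

theorem zero_mem_perspectiveCone (A : Set E) : (0 : ℝ × E) ∈ perspectiveCone A :=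
  mem_insert _ _

theorem mem_perspectiveCone_iff {A : Set E} {p : ℝ × E} :
    p ∈ perspectiveCone A ↔ p = 0 ∨ 0 < p.1 ∧ p.1⁻¹ • p.2 ∈ A := by
  constructor
  · rintro (rfl | ⟨t, ht, x, hx, rfl⟩)
    · exact Or.inl rfl
    · rcases ht.eq_or_lt with rfl | ht
      · left; simp
      · right
        simpa [ht, smul_smul, ht.ne'] using hx
  · rintro (rfl | ⟨h, hx⟩)
    · exact zero_mem_perspectiveCone A
    · refine Or.inr ⟨p.1, h.le, _, hx, Prod.ext rfl ?_⟩
      simp [smul_smul, h.ne']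

theorem mk_smul_mem_perspectiveCone_iff {A : Set E} {t : ℝ} (ht : 0 < t) {x : E} :
    (t, t • x) ∈ perspectiveCone A ↔ x ∈ A := by
  rw [mem_perspectiveCone_iff]
  simp [ht, ht.ne', smul_smul]

theorem perspectiveCone_mono {A B : Set E} (h : A ⊆ B) :
    perspectiveCone A ⊆ perspectiveCone B := fun p => by
  simp only [mem_perspectiveCone_iff]
  exact Or.imp_right (And.imp_right (@h _))

theorem Convex.perspectiveCone {A : Set E} (hA : Convex ℝ A) : Convex ℝ (perspectiveCone A) := by
  rw [convex_iff_forall_pos]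
  rintro p hp q hq a b ha hb -
  rcases mem_perspectiveCone_iff.1 hp with rfl | ⟨hp0, hpA⟩ <;>
    rcases mem_perspectiveCone_iff.1 hq with rfl | ⟨hq0, hqA⟩ <;>
    rw [mem_perspectiveCone_iff]
  · simp
  · right
    have : 0 < b * q.1 := by positivity
    refine ⟨by simpa using this, ?_⟩
    convert hqA using 1
    simp [smul_smul]
    field_simp
  · right
    have : 0 < a * p.1 := by positivity
    refine ⟨by simpa using this, ?_⟩
    convert hpA using 1
    simp [smul_smul]
    field_simp
  · right
    have h1 : 0 < a * p.1 := by positivity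
    have h2 : 0 < b * q.1 := by positivity
    have h3 : 0 < a * p.1 + b * q.1 := by positivity
    refine ⟨by simpa using h3, ?_⟩
    convert hA hpA hqA (a := (a * p.1) / (a * p.1 + b * q.1))
      (b := (b * q.1) / (a * p.1 + b * q.1)) (by positivity) (by positivity)
      (by field_simp) using 1
    simp only [Prod.fst_add, Prod.snd_add, Prod.smul_fst, Prod.smul_snd, smul_eq_mul, smul_add,
      smul_smul]
    congr 2 <;> field_simp

-- At height `t > 0`, divide by the height and use closedness of `A`. At height `0`, the bound `‖y‖
-- ≤ t R` leaves only the origin; for unbounded `A`, recession directions could appear there.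
open Filter Topology in
theorem IsClosed.perspectiveCone {A : Set E} (hA : IsClosed A) (hb : Bornology.IsBounded A) :
    IsClosed (perspectiveCone A) := by
  obtain ⟨R, hR⟩ := hb.exists_norm_le
  refine isClosed_of_closure_subset fun p hp => ?_
  obtain ⟨u, hu, hlim⟩ := mem_closure_iff_seq_limit.1 hp
  have h1 : Tendsto (fun n => (u n).1) atTop (𝓝 p.1) := (continuous_fst.tendsto p).comp hlim
  have h2 : Tendsto (fun n => (u n).2) atTop (𝓝 p.2) := (continuous_snd.tendsto p).comp hlim
  have hu' := fun n => mem_perspectiveCone_iff.1 (hu n)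
  have h0 : 0 ≤ p.1 := ge_of_tendsto' h1 fun n => by
    rcases hu' n with h | ⟨h, -⟩
    · simp [h]
    · exact h.le
  rw [mem_perspectiveCone_iff]
  rcases h0.eq_or_lt with h0 | h0
  · left
    have hle : ‖p.2‖ ≤ p.1 * R := by
      refine le_of_tendsto_of_tendsto' h2.norm (h1.mul_const R) fun n => ?_
      rcases hu' n with h | ⟨h, hx⟩
      · simp [h]
      · have := hR _ hx
        rw [norm_smul, norm_inv, Real.norm_of_nonneg h.le, inv_mul_le_iff₀ h] at this
        exact this
    rw [← h0, zero_mul, norm_le_zero_iff] at hle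
    exact Prod.ext h0.symm hle
  · right
    refine ⟨h0, hA.mem_of_tendsto ((h1.inv₀ h0.ne').smul h2) ?_⟩
    filter_upwards [h1.eventually (lt_mem_nhds h0)] with n hn
    rcases hu' n with h | ⟨-, hx⟩
    · exact absurd hn (by simp [h])
    · exact hx

theorem IsRandomSet.perspectiveCone {Ω : Type*} [MeasurableSpace E] [BorelSpace E]
    [SecondCountableTopology E] {G : MeasurableSpace Ω} {X : Ω → Set E} (hX : IsRandomSet G X) :
    IsRandomSet G fun ω => perspectiveCone (X ω) := by
  have h1 : Measurable fun p : ℝ × E => p.1⁻¹ • p.2 := by fun_prop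
  have h2 : MeasurableSet {p : ℝ × E | 0 < p.1} := measurableSet_lt measurable_const measurable_fst
  have := (IsRandomSet.const G (measurableSet_singleton (0 : ℝ × E))).union
    ((IsRandomSet.const G h2).inter (hX.preimage h1))
  convert this using 2 with ω
  ext p
  exact mem_perspectiveCone_iff

end PerspectiveCone

/-! ### Cores and hulls commute with the cone -/

section Banach

variable {Ω E : Type*} [NormedAddCommGroup E] [NormedSpace ℝ E]
  [SecondCountableTopology E] [MeasurableSpace E] [BorelSpace E]
  {H mΩ : MeasurableSpace Ω}

/-- The rescaled image of `Z` need not have a measurable graph, but its closure does up to null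
sets, and the closure stays in `X` because `X` is closed. -/
theorem IsCondCore.perspectiveCone [CompleteSpace E] (hH : H ≤ mΩ) {P : Measure Ω}
    [IsFiniteMeasure P] {X C : Ω → Set E} (hX : ∀ᵐ ω ∂P, IsClosed (X ω)) (hC : IsCondCore P H X C) :
    IsCondCore P H (fun ω => perspectiveCone (X ω)) (fun ω => perspectiveCone (C ω)) := by
  refine ⟨hC.measurable_graph.perspectiveCone, hC.subset.mono fun ω => perspectiveCone_mono,
    fun Z hZ hZX => ?_⟩
  have hpos : MeasurableSet {p : ℝ × E | 0 < p.1} :=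
    measurableSet_lt measurable_const measurable_fst
  obtain ⟨V, hV, hVZ⟩ := (hZ.inter (.const H hpos)).exists_ae_eq_closure_image hH P
    (g := fun p : ℝ × E => p.1⁻¹ • p.2) (by fun_prop)
  have hVC : ∀ᵐ ω ∂P, V ω ⊆ C ω := by
    refine hC.largest V hV ?_
    filter_upwards [hVZ, hX, hZX] with ω h1 h2 h3
    rw [h1]
    refine closure_minimal ?_ h2
    rintro _ ⟨p, ⟨hp, hp0⟩, rfl⟩
    rcases mem_perspectiveCone_iff.1 (h3 hp) with rfl | h
    · exact absurd hp0 (lt_irrefl (0 : ℝ))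
    · exact h.2
  filter_upwards [hVZ, hVC, hZX] with ω h1 h2 h3 p hp
  refine mem_perspectiveCone_iff.2 ((mem_perspectiveCone_iff.1 (h3 hp)).imp_right fun h => ?_)
  exact ⟨h.1, h2 (h1 ▸ subset_closure ⟨p, ⟨hp, h.1⟩, rfl⟩)⟩

open Filter Topology in
theorem IsCondConvexHull.perspectiveCone {P : Measure Ω} {X D : Ω → Set E}
    (hD : IsCondConvexHull P H X D) (hb : ∀ᵐ ω ∂P, Bornology.IsBounded (D ω)) :
    IsCondConvexHull P H (fun ω => perspectiveCone (X ω)) (fun ω => perspectiveCone (D ω)) := by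
  refine ⟨⟨hD.convexClosed.measurable_graph.perspectiveCone, ?_, ?_⟩,
    hD.superset.mono fun ω => perspectiveCone_mono, fun Z hZ hXZ => ?_⟩
  · filter_upwards [hD.convexClosed.closed, hb] with ω h1 h2 using h1.perspectiveCone h2
  · exact hD.convexClosed.convex.mono fun ω h => h.perspectiveCone
  -- Minimality of `D` yields one null set per height, hence the restriction to countably many
  -- heights.
  have key : ∀ q : {q : ℚ // 0 < q}, ∀ᵐ ω ∂P,
      D ω ⊆ (fun x : E => ((q.1 : ℝ), (q.1 : ℝ) • x)) ⁻¹' Z ω := by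
    intro q
    have hq : (0 : ℝ) < q.1 := by exact_mod_cast q.2
    refine hD.smallest _ ⟨hZ.measurable_graph.preimage (by fun_prop), ?_, ?_⟩ ?_
    · exact hZ.closed.mono fun ω h => h.preimage (by fun_prop)
    · filter_upwards [hZ.convex] with ω h x hx y hy a b ha hb hab
      have := h hx hy ha hb hab
      simp only [mem_preimage]
      convert this using 1
      ext
      · simp [← add_mul, hab]
      · simp [smul_smul, mul_comm]
    · filter_upwards [hXZ] with ω h x hx
      exact h ((mk_smul_mem_perspectiveCone_iff hq).2 hx)
  filter_upwards [ae_all_iff.2 key, hZ.closed, hXZ] with ω h1 h2 h3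
  rintro p (rfl | ⟨t, ht, x, hx, rfl⟩)
  · exact h3 (zero_mem_perspectiveCone _)
  -- Approximating from strictly above keeps the rationals positive even when `t = 0`.
  obtain ⟨u, -, hu, hlim⟩ := Real.exists_seq_rat_strictAnti_tendsto t
  have hc : Continuous fun s : ℝ => (s, s • x) := by fun_prop
  exact h2.mem_of_tendsto ((hc.tendsto t).comp hlim) (Eventually.of_forall fun n =>
    h1 ⟨u n, by exact_mod_cast ht.trans_lt (hu n)⟩ hx)

end Banach

theorem proposition7p2 {Ω E : Type*} [NormedAddCommGroup E] [NormedSpace ℝ E] [CompleteSpace E]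
    [SecondCountableTopology E] [MeasurableSpace E] [BorelSpace E]
    (H : MeasurableSpace Ω) [mΩ : MeasurableSpace Ω] (hH : H ≤ mΩ)
    (P : Measure[mΩ] Ω) [IsProbabilityMeasure P] [P.IsComplete]
    (X : Ω → Set E) (hX : IsRandomConvexClosed P mΩ X) :
    ((∃ C : Ω → Set E, IsCondCore P H X C) ∧
      ∀ C : Ω → Set E, IsCondCore P H X C →
        IsCondCore P H (fun ω => perspectiveCone (X ω)) (fun ω => perspectiveCone (C ω))) ∧
    ((∃ D : Ω → Set E, IsCondConvexHull P H X D) ∧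
      ∀ D : Ω → Set E, IsCondConvexHull P H X D → (∀ᵐ ω ∂P, Bornology.IsBounded (D ω)) →
        IsCondConvexHull P H (fun ω => perspectiveCone (X ω))
          (fun ω => perspectiveCone (D ω))) :=
  ⟨⟨exists_isCondCore hH P hX.closed, fun _ hC => hC.perspectiveCone hH hX.closed⟩,
    exists_isCondConvexHull hH P X, fun _ hD hb => hD.perspectiveCone hb⟩
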